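/- Let $E_u$ be a Dedekind complete (real) Riesz space with a strong unit $u$, i.e. $u\ge 0$ and for every $x\in E_u$ there is $c\in\mathbb{R}$ with $|x|\le c\,u$. Then there is exactly one $f$-algebra multiplication on $E_u$ whose algebra unit is $u$ (an $f$-algebra multiplication is an associative bilinear multiplication for which products of positive elements are positive, and such that $x\wedge y=0$ and $z\ge 0$ imply $(zx)\wedge y=(xz)\wedge y=0$). With respect to this multiplication and with $x^0=u$, for every $x\in E_u$ the sequence of partial sums \[ S_n(x)=\sum_{k=0}^{n}\frac{1}{k!}\,x^k \qquad (n\ge 0) \] order converges to an element of $E_u$: there are $y\in E_u$ and a decreasing sequence $(p_n)$ in $E_u$ with $\inf_n p_n=0$ and $|S_n(x)-y|\le p_n$ for all $n$. The order limit $y$ is unique and is denoted $\exp(x)$. Moreover, the convergence is relatively uniform with regulator $u$: for every real $\varepsilon>0$ there is $N\in\mathbb{N}$ such that $|S_n(x)-\exp(x)|\le\varepsilon u$ for all $n\ge N$. -/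

import Mathlib

/-- `u` is a strong (order) unit of the Riesz space `E`: it is positive and the order ideal
generated by `u` is all of `E`. -/
def IsStrongUnit {E : Type*} [AddCommGroup E] [Lattice E] [Module ℝ E] (u : E) : Prop :=
  0 ≤ u ∧ ∀ x : E, ∃ c : ℝ, |x| ≤ c • u

/-- The bilinear map `m` is an `f`-algebra multiplication on the Riesz space `E` with algebra
unit `u`: it is associative, products of positive elements are positive, multiplication by a
positive element preserves disjointness (the `f`-algebra property), and `u` is a two-sided unit. -/
structure IsFAlgebraMul {E : Type*} [AddCommGroup E] [Lattice E] [Module ℝ E]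
    (u : E) (m : E →ₗ[ℝ] E →ₗ[ℝ] E) : Prop where
  assoc : ∀ x y z : E, m (m x y) z = m x (m y z)
  nonneg : ∀ x y : E, 0 ≤ x → 0 ≤ y → 0 ≤ m x y
  left_disjoint : ∀ x y z : E, x ⊓ y = 0 → 0 ≤ z → m z x ⊓ y = 0
  right_disjoint : ∀ x y z : E, x ⊓ y = 0 → 0 ≤ z → m x z ⊓ y = 0
  unit_mul : ∀ x : E, m u x = x
  mul_unit : ∀ x : E, m x u = x

/-- Powers for the multiplication `m` with unit `u`: `x ^ 0 = u` and `x ^ (k + 1) = x ^ k * x`. -/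
def fPow {E : Type*} [AddCommGroup E] [Module ℝ E] (u : E) (m : E →ₗ[ℝ] E →ₗ[ℝ] E) (x : E) :
    ℕ → E
  | 0 => u
  | k + 1 => m (fPow u m x k) x

/-- The partial sums `S_n(x) = ∑_{k = 0}^n x ^ k / k!` of the exponential series. -/
noncomputable def expPartialSum {E : Type*} [AddCommGroup E] [Module ℝ E]
    (u : E) (m : E →ₗ[ℝ] E →ₗ[ℝ] E) (x : E) (n : ℕ) : E :=
  ∑ k ∈ Finset.range (n + 1), (1 / (Nat.factorial k : ℝ)) • fPow u m x k

/-- Order convergence of a sequence: `|s n - y| ≤ p n` for some sequence `p n ↓ 0`. -/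
def OrderTendsto {E : Type*} [AddCommGroup E] [Lattice E] (s : ℕ → E) (y : E) : Prop :=
  ∃ p : ℕ → E, Antitone p ∧ IsGLB (Set.range p) 0 ∧ ∀ n, |s n - y| ≤ p n

/-- Relatively uniform convergence of a sequence with regulator `v`. -/
def RelUniformTendsto {E : Type*} [AddCommGroup E] [Lattice E] [Module ℝ E]
    (v : E) (s : ℕ → E) (y : E) : Prop :=
  ∀ ε : ℝ, 0 < ε → ∃ N : ℕ, ∀ n ≥ N, |s n - y| ≤ ε • v

set_option linter.unusedSectionVars false

/-! ### Order ideals maximal among those avoiding `u`. -/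

section SolidSubmodule

open LatticeOrderedAddCommGroup

variable {E : Type*} [AddCommGroup E] [Lattice E] [IsOrderedAddMonoid E] [Module ℝ E]
  [IsOrderedModule ℝ E]

/-! This is Yosida's representation without the topology: `E` is studied through its unital Riesz
homomorphisms `φ` to `ℝ`. An order ideal maximal without `u` has quotient `ℝ`, so Zorn's lemma gives
enough `φ` to determine the order (`le_of_forall_isUnitalRieszHom`). By completeness, a function of
`φ` uniformly approximable by elements of `E` is itself an element (`exists_of_forall_approx`).

Squares are approximated by finite suprema of tangents, and polarization gives products. Every
admissible multiplication is multiplicative under each `φ` (`IsFAlgebraMul.map_mul`), hence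
uniqueness. The exponential reduces to the real Taylor series, uniform on `[-c, c]` when `|x| ≤ c •
u`. -/

theorem abs_real_smul_le (c : ℝ) (x : E) : |c • x| ≤ |c| • |x| := by
  have h : ∀ d : ℝ, d • x ≤ |d| • |x| := fun d => by
    rcases le_total 0 d with hd | hd
    · rw [abs_of_nonneg hd]
      exact smul_le_smul_of_nonneg_left (le_abs_self x) hd
    · rw [abs_of_nonpos hd, ← neg_smul_neg]
      exact smul_le_smul_of_nonneg_left (neg_le_abs x) (neg_nonneg.2 hd)
  refine abs_le'.2 ⟨h c, ?_⟩
  simpa using h (-c)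

theorem abs_smul_of_nonneg_right (c : ℝ) {x : E} (hx : 0 ≤ x) : |c • x| = |c| • x := by
  rcases le_total 0 c with hc | hc
  · rw [abs_of_nonneg hc, abs_of_nonneg (smul_nonneg hc hx)]
  · rw [abs_of_nonpos hc, neg_smul, abs_of_nonpos (smul_nonpos_of_nonpos_of_nonneg hc hx)]

theorem smul_inf_smul_eq_zero {a b : E} (hab : a ⊓ b = 0) {c : ℝ} (hc : 0 ≤ c) :
    c • a ⊓ c • b = 0 := by
  rcases hc.eq_or_lt with rfl | hc
  · simp
  refine le_antisymm ?_ (le_inf ?_ ?_)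
  · have h : c⁻¹ • (c • a ⊓ c • b) ≤ 0 := by
      rw [← hab]
      refine le_inf ?_ ?_
      · simpa [smul_smul, hc.ne'] using
          smul_le_smul_of_nonneg_left (inf_le_left : c • a ⊓ c • b ≤ _) (inv_pos.2 hc).le
      · simpa [smul_smul, hc.ne'] using
          smul_le_smul_of_nonneg_left (inf_le_right : c • a ⊓ c • b ≤ _) (inv_pos.2 hc).le
    simpa [smul_smul, hc.ne'] using smul_le_smul_of_nonneg_left h hc.le
  · exact smul_nonneg hc.le (hab ▸ inf_le_left)
  · exact smul_nonneg hc.le (hab ▸ inf_le_right)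

/-- The solid submodule generated by a solid submodule `M` and an element `w`. -/
def solidAdjoin (M : Submodule ℝ E) (w : E) : Submodule ℝ E where
  carrier := {z | ∃ m ∈ M, ∃ c : ℝ, 0 ≤ c ∧ |z| ≤ m + c • |w|}
  zero_mem' := ⟨0, M.zero_mem, 0, le_rfl, by simp⟩
  add_mem' := by
    rintro a b ⟨m, hm, c, hc, h⟩ ⟨m', hm', c', hc', h'⟩
    refine ⟨m + m', M.add_mem hm hm', c + c', add_nonneg hc hc', (abs_add_le a b).trans ?_⟩
    rw [add_smul, add_add_add_comm]
    exact add_le_add h h'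
  smul_mem' := by
    rintro r a ⟨m, hm, c, hc, h⟩
    refine ⟨|r| • m, M.smul_mem _ hm, |r| * c, by positivity, (abs_real_smul_le r a).trans ?_⟩
    rw [mul_smul, ← smul_add]
    exact smul_le_smul_of_nonneg_left h (abs_nonneg r)

theorem isSolid_solidAdjoin (M : Submodule ℝ E) (w : E) :
    IsSolid (solidAdjoin M w : Set E) := by
  rintro x ⟨m, hm, c, hc, h⟩ y hy
  exact ⟨m, hm, c, hc, hy.trans h⟩

theorem mem_solidAdjoin_self (M : Submodule ℝ E) (w : E) : w ∈ solidAdjoin M w :=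
  ⟨0, M.zero_mem, 1, zero_le_one, by simp⟩

theorem IsSolidSubmodule.abs_mem {M : Submodule ℝ E} (hM : IsSolid (M : Set E)) {x : E}
    (hx : x ∈ M) : |x| ∈ M := hM hx (by simp)

theorem IsSolidSubmodule.mem_of_le {M : Submodule ℝ E} (hM : IsSolid (M : Set E)) {x y : E}
    (hx : 0 ≤ x) (hxy : x ≤ y) (hy : y ∈ M) : x ∈ M :=
  hM hy (by rw [abs_of_nonneg hx]; exact hxy.trans (le_abs_self y))

theorem le_solidAdjoin {M : Submodule ℝ E} (hM : IsSolid (M : Set E)) (w : E) :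
    M ≤ solidAdjoin M w := fun x hx =>
  ⟨|x|, IsSolidSubmodule.abs_mem hM hx, 0, le_rfl, by simp⟩

/-- `M` is maximal among the solid submodules that do not contain `u`. -/
def IsMaximalSolid (u : E) (M : Submodule ℝ E) : Prop :=
  Maximal (· ∈ {N : Submodule ℝ E | IsSolid (N : Set E) ∧ u ∉ N}) M

theorem exists_isMaximalSolid_ge {u : E} {M : Submodule ℝ E} (hM : IsSolid (M : Set E))
    (hu : u ∉ M) : ∃ N, M ≤ N ∧ IsMaximalSolid u N := by
  refine zorn_le_nonempty₀ _ (fun c hc hchain N hN => ?_) M ⟨hM, hu⟩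
  have hmem : ∀ z, z ∈ sSup c ↔ ∃ K ∈ c, z ∈ K := fun z =>
    Submodule.mem_sSup_of_directed ⟨N, hN⟩ hchain.directedOn
  refine ⟨sSup c, ⟨fun x hx y hy => ?_, fun h => ?_⟩, fun K hK => le_sSup hK⟩
  · obtain ⟨K, hK, hxK⟩ := (hmem x).1 hx
    exact (hmem y).2 ⟨K, hK, (hc hK).1 hxK hy⟩
  · obtain ⟨K, hK, hxK⟩ := (hmem u).1 h
    exact (hc hK).2 hxK

namespace IsMaximalSolid

variable {u : E} {M : Submodule ℝ E}

theorem exists_le (hM : IsMaximalSolid u M) {w : E} (hw : w ∉ M) :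
    ∃ m ∈ M, ∃ c : ℝ, 0 ≤ c ∧ u ≤ m + c • |w| := by
  by_contra h
  refine hw (hM.2 (y := solidAdjoin M w) ⟨isSolid_solidAdjoin M w, ?_⟩
    (le_solidAdjoin hM.1.1 w) (mem_solidAdjoin_self M w))
  rintro ⟨m, hm, c, hc, hle⟩
  exact h ⟨m, hm, c, hc, (le_abs_self u).trans hle⟩

/-- Primeness: otherwise `u` lies, modulo `M`, below multiples of both `a` and `b`, whose infimum is
zero. -/
theorem mem_or_mem (hM : IsMaximalSolid u M) (hu : 0 ≤ u) {a b : E} (hab : a ⊓ b = 0) :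
    a ∈ M ∨ b ∈ M := by
  by_contra! h
  have ha : 0 ≤ a := hab ▸ inf_le_left
  have hb : 0 ≤ b := hab ▸ inf_le_right
  obtain ⟨m, hm, c, hc, hle⟩ := hM.exists_le h.1
  obtain ⟨m', hm', c', hc', hle'⟩ := hM.exists_le h.2
  rw [abs_of_nonneg ha] at hle
  rw [abs_of_nonneg hb] at hle'
  have hm0 := IsSolidSubmodule.abs_mem hM.1.1 hm
  have hm0' := IsSolidSubmodule.abs_mem hM.1.1 hm'
  have key : u ≤ |m| + |m'| := by
    have h1 : u ≤ (|m| + |m'|) + (c + c') • a := by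
      refine hle.trans (add_le_add ?_ (smul_le_smul_of_nonneg_right (by linarith) ha))
      exact (le_abs_self m).trans (le_add_of_nonneg_right (abs_nonneg m'))
    have h2 : u ≤ (|m| + |m'|) + (c + c') • b := by
      refine hle'.trans (add_le_add ?_ (smul_le_smul_of_nonneg_right (by linarith) hb))
      exact (le_abs_self m').trans (le_add_of_nonneg_left (abs_nonneg m))
    have h3 := le_inf h1 h2
    rwa [← add_inf, smul_inf_smul_eq_zero hab (add_nonneg hc hc'), add_zero] at h3
  exact hM.1.2 (IsSolidSubmodule.mem_of_le hM.1.1 hu key (M.add_mem hm0 hm0'))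

theorem mem_of_forall_abs_le (hM : IsMaximalSolid u M) (hu : 0 ≤ u) {w : E}
    (h : ∀ ε : ℝ, 0 < ε → ∃ m ∈ M, |w| ≤ m + ε • u) : w ∈ M := by
  by_contra hw
  obtain ⟨m, hm, c, hc, hle⟩ := hM.exists_le hw
  -- This tolerance makes `c * ε ≤ 1 / 2`, so half of `u` would fall into `M`.
  obtain ⟨m', hm', hle'⟩ := h (1 / (2 * (c + 1))) (by positivity)
  have h1 : u ≤ m + c • m' + (1 / 2 : ℝ) • u := by
    refine hle.trans ?_
    rw [add_assoc]
    refine add_le_add le_rfl ((smul_le_smul_of_nonneg_left hle' hc).trans ?_)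
    rw [smul_add, smul_smul]
    refine add_le_add le_rfl (smul_le_smul_of_nonneg_right ?_ hu)
    rw [mul_one_div, div_le_div_iff₀ (by positivity) two_pos]
    linarith
  have h2 : (1 / 2 : ℝ) • u ≤ m + c • m' := by
    rw [← sub_le_iff_le_add] at h1
    convert h1 using 1
    module
  have h3 := IsSolidSubmodule.mem_of_le hM.1.1 (smul_nonneg (by norm_num) hu) h2
    (M.add_mem hm (M.smul_mem c hm'))
  exact hM.1.2 ((M.smul_mem_iff (by norm_num)).1 h3)

/-- The value of `y` modulo `M` is a cut: above it the positive part of `y - t • u` is in `M`; below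
it primeness puts the negative part there. -/
theorem exists_sub_smul_mem (hM : IsMaximalSolid u M) (hu : IsStrongUnit u) (y : E) :
    ∃ t : ℝ, y - t • u ∈ M := by
  set A : Set ℝ := {t | (y - t • u)⁺ ∈ M} with hA
  obtain ⟨c, hc⟩ := hu.2 y
  have hcA : c ∈ A := by
    have : (y - c • u)⁺ = 0 :=
      posPart_eq_zero.2 (sub_nonpos.2 ((le_abs_self y).trans hc))
    simp [hA, this]
  have hup : ∀ s ∈ A, ∀ t, s ≤ t → t ∈ A := fun s hs t hst =>
    IsSolidSubmodule.mem_of_le hM.1.1 (posPart_nonneg _)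
      (posPart_mono (sub_le_sub_left (smul_le_smul_of_nonneg_right hst hu.1) y)) hs
  have hbdd : ∀ t ∈ A, -c ≤ t := by
    intro t ht
    by_contra! hlt
    have h1 : (-c - t) • u ≤ (y - t • u)⁺ := by
      refine le_trans ?_ (le_posPart _)
      rw [sub_smul, neg_smul]
      exact sub_le_sub_right (neg_le.1 ((neg_le_abs y).trans hc)) _
    have h2 := IsSolidSubmodule.mem_of_le hM.1.1 (smul_nonneg (by linarith) hu.1) h1 ht
    exact hM.1.2 ((M.smul_mem_iff (by linarith)).1 h2)
  have hB : BddBelow A := ⟨-c, fun t ht => hbdd t ht⟩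
  refine ⟨sInf A, hM.mem_of_forall_abs_le hu.1 fun ε hε => ?_⟩
  set t := sInf A
  have h1 : (y - (t + ε / 2) • u)⁺ ∈ M := by
    obtain ⟨s, hs, hst⟩ := exists_lt_of_csInf_lt ⟨c, hcA⟩ (lt_add_of_pos_right t (half_pos hε))
    exact hup s hs _ hst.le
  have h2 : (y - (t - ε / 2) • u)⁻ ∈ M := by
    refine (hM.mem_or_mem hu.1 (posPart_inf_negPart_eq_zero (y - (t - ε / 2) • u))).resolve_left
      fun h => ?_
    have := csInf_le hB h
    change t ≤ _ at this
    linarith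
  refine ⟨_, M.add_mem h1 h2, ?_⟩
  have h3 : y - t • u ≤ (y - (t + ε / 2) • u)⁺ + (ε / 2) • u := by
    refine le_trans (le_of_eq ?_) (add_le_add (le_posPart (y - (t + ε / 2) • u)) le_rfl)
    module
  have h4 : -(y - t • u) ≤ (y - (t - ε / 2) • u)⁻ + (ε / 2) • u := by
    refine le_trans (le_of_eq ?_) (add_le_add (neg_le_negPart (y - (t - ε / 2) • u)) le_rfl)
    module
  have h5 : (ε / 2) • u ≤ ε • u := smul_le_smul_of_nonneg_right (by linarith) hu.1
  refine abs_le'.2 ⟨h3.trans (add_le_add ?_ h5), h4.trans (add_le_add ?_ h5)⟩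
  · exact le_add_of_nonneg_right (negPart_nonneg _)
  · exact le_add_of_nonneg_left (posPart_nonneg _)

end IsMaximalSolid

/-- A real-valued Riesz homomorphism that takes the value `1` at `u`. -/
structure IsUnitalRieszHom (u : E) (φ : E →ₗ[ℝ] ℝ) : Prop where
  map_unit : φ u = 1
  map_abs : ∀ x, φ |x| = |φ x|

theorem IsMaximalSolid.exists_isUnitalRieszHom {u : E} {M : Submodule ℝ E}
    (hM : IsMaximalSolid u M) (hu : IsStrongUnit u) :
    ∃ φ : E →ₗ[ℝ] ℝ, IsUnitalRieszHom u φ ∧ ∀ x ∈ M, φ x = 0 := by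
  choose f hf using hM.exists_sub_smul_mem hu
  have huniq : ∀ y t, y - t • u ∈ M → f y = t := by
    intro y t ht
    by_contra hne
    have h : (t - f y) • u ∈ M := by
      convert M.sub_mem (hf y) ht using 1
      module
    exact hM.1.2 ((M.smul_mem_iff (sub_ne_zero.2 (Ne.symm hne))).1 h)
  refine ⟨{ toFun := f, map_add' := fun x y => huniq _ _ ?_, map_smul' := fun c x => huniq _ _ ?_ },
    ⟨huniq _ _ (by simp), fun x => huniq _ _ ?_⟩, fun x hx => huniq _ _ (by simpa using hx)⟩
  · convert M.add_mem (hf x) (hf y) using 1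
    module
  · convert M.smul_mem c (hf x) using 1
    simp only [RingHom.id_apply, smul_eq_mul]
    module
  · change |x| - |f x| • u ∈ M
    -- Solidity and the reverse triangle inequality make the quotient map commute with `|·|`.
    refine hM.1.1 (hf x) (le_trans (le_of_eq ?_) (abs_abs_sub_abs_le x (f x • u)))
    rw [abs_smul_of_nonneg_right _ hu.1]

end SolidSubmodule

/-! ### Calculus of unital Riesz homomorphisms. -/

namespace IsUnitalRieszHom

variable {E : Type*} [AddCommGroup E] [Lattice E] [IsOrderedAddMonoid E] [Module ℝ E]
  {u : E} {φ : E →ₗ[ℝ] ℝ}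

theorem nonneg (hφ : IsUnitalRieszHom u φ) {x : E} (hx : 0 ≤ x) : 0 ≤ φ x := by
  rw [← abs_of_nonneg hx, hφ.map_abs]
  exact abs_nonneg _

theorem mono (hφ : IsUnitalRieszHom u φ) {x y : E} (h : x ≤ y) : φ x ≤ φ y := by
  have := hφ.nonneg (sub_nonneg.2 h)
  rw [map_sub] at this
  linarith

theorem map_smul_unit (hφ : IsUnitalRieszHom u φ) (c : ℝ) : φ (c • u) = c := by
  simp [hφ.map_unit]

theorem map_inf (hφ : IsUnitalRieszHom u φ) (x y : E) : φ (x ⊓ y) = φ x ⊓ φ y := by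
  have h := congrArg φ (two_nsmul_inf_eq_add_sub_abs_sub x y)
  have h' := two_nsmul_inf_eq_add_sub_abs_sub (φ x) (φ y)
  simp only [map_nsmul, map_sub, map_add, hφ.map_abs, nsmul_eq_mul, Nat.cast_ofNat] at h h'
  linarith

theorem map_sup (hφ : IsUnitalRieszHom u φ) (x y : E) : φ (x ⊔ y) = φ x ⊔ φ y := by
  have h := congrArg φ (inf_add_sup x y)
  have h' := inf_add_sup (φ x) (φ y)
  rw [map_add, hφ.map_inf, map_add] at h
  linarith

theorem abs_le (hφ : IsUnitalRieszHom u φ) {x : E} {c : ℝ} (h : |x| ≤ c • u) : |φ x| ≤ c := by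
  rw [← hφ.map_abs, ← hφ.map_smul_unit c]
  exact hφ.mono h

end IsUnitalRieszHom

/-! ### Separation, representation and the product. -/

section DedekindComplete

open LatticeOrderedAddCommGroup

variable {E : Type*} [AddCommGroup E] [ConditionallyCompleteLattice E]
    [IsOrderedAddMonoid E] [Module ℝ E] [IsOrderedModule ℝ E] {u : E}

/-- The Archimedean property: the supremum of the positive multiples of `x` can be lowered by `x`
and remain an upper bound. -/
theorem nonpos_of_forall_le_smul {x u : E} (h : ∀ ε : ℝ, 0 < ε → x ≤ ε • u) : x ≤ 0 := by
  set S : Set E := Set.range fun n : ℕ => ((n : ℝ) + 1) • x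
  have hS : BddAbove S := by
    refine ⟨u, ?_⟩
    rintro _ ⟨n, rfl⟩
    have hn : (0 : ℝ) < (n : ℝ) + 1 := by positivity
    simpa [smul_smul, hn.ne'] using smul_le_smul_of_nonneg_left (h _ (inv_pos.2 hn)) hn.le
  have h1 : sSup S ≤ sSup S - x := by
    refine csSup_le (Set.range_nonempty _) ?_
    rintro _ ⟨n, rfl⟩
    rw [le_sub_iff_add_le]
    refine le_csSup hS ⟨n + 1, ?_⟩
    push_cast
    module
  simpa using h1

theorem exists_isUnitalRieszHom_pos (hu : IsStrongUnit u) {x : E} (hx : ¬ x ≤ 0) :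
    ∃ φ : E →ₗ[ℝ] ℝ, IsUnitalRieszHom u φ ∧ 0 < φ x := by
  obtain ⟨ε, hε, hxε⟩ : ∃ ε : ℝ, 0 < ε ∧ ¬ x ≤ ε • u := by
    by_contra! h
    exact hx (nonpos_of_forall_le_smul h)
  set p := (x - ε • u)⁺ with hp
  set w := (x - ε • u)⁻ with hw
  have hp0 : 0 ≤ p := posPart_nonneg _
  have hw0 : 0 ≤ w := negPart_nonneg _
  -- Otherwise `p` would lie below a multiple of the disjoint `w`, hence vanish. A `φ` killing `w`
  -- then gives `φ x ≥ ε`.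
  have hnot : u ∉ solidAdjoin (⊥ : Submodule ℝ E) w := by
    rintro ⟨m, hm, n, hn, hle⟩
    rw [(Submodule.mem_bot ℝ).1 hm, zero_add, abs_of_nonneg hu.1, abs_of_nonneg hw0] at hle
    obtain ⟨c, hc⟩ := hu.2 p
    have h1 : p ≤ (1 + |c| * n) • w := by
      calc p ≤ c • u := (le_abs_self p).trans hc
        _ ≤ |c| • u := smul_le_smul_of_nonneg_right (le_abs_self c) hu.1
        _ ≤ |c| • n • w := smul_le_smul_of_nonneg_left hle (abs_nonneg c)
        _ ≤ (1 + |c| * n) • w := by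
          rw [smul_smul]
          exact smul_le_smul_of_nonneg_right (by linarith) hw0
    have h2 : p ≤ (1 + |c| * n) • p := by
      have : 0 ≤ |c| * n := by positivity
      simpa using smul_le_smul_of_nonneg_right (by linarith : (1 : ℝ) ≤ 1 + |c| * n) hp0
    have h3 := le_inf h2 h1
    rw [smul_inf_smul_eq_zero (posPart_inf_negPart_eq_zero _) (by positivity)] at h3
    exact hxε (sub_nonpos.1 ((le_posPart _).trans h3))
  obtain ⟨M, hle, hM⟩ := exists_isMaximalSolid_ge (isSolid_solidAdjoin _ w) hnot
  obtain ⟨φ, hφ, hker⟩ := hM.exists_isUnitalRieszHom hu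
  refine ⟨φ, hφ, ?_⟩
  have h1 : φ w = 0 := hker w (hle (mem_solidAdjoin_self _ w))
  have h2 := congrArg φ (posPart_sub_negPart (x - ε • u))
  rw [map_sub, ← hp, ← hw, h1, map_sub, hφ.map_smul_unit] at h2
  have h3 := hφ.nonneg hp0
  linarith

theorem le_of_forall_isUnitalRieszHom (hu : IsStrongUnit u) {x y : E}
    (h : ∀ φ : E →ₗ[ℝ] ℝ, IsUnitalRieszHom u φ → φ x ≤ φ y) : x ≤ y := by
  by_contra hxy
  obtain ⟨φ, hφ, hpos⟩ := exists_isUnitalRieszHom_pos hu (x := x - y) (by rwa [sub_nonpos])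
  have := h φ hφ
  rw [map_sub] at hpos
  linarith

theorem eq_of_forall_isUnitalRieszHom (hu : IsStrongUnit u) {x y : E}
    (h : ∀ φ : E →ₗ[ℝ] ℝ, IsUnitalRieszHom u φ → φ x = φ y) : x = y :=
  le_antisymm (le_of_forall_isUnitalRieszHom hu fun φ hφ => (h φ hφ).le)
    (le_of_forall_isUnitalRieszHom hu fun φ hφ => (h φ hφ).ge)

/-- A function on the unital Riesz homomorphisms that is uniformly approximated by elements of `E`
is represented by an element of `E`. -/
theorem exists_of_forall_approx (hu : IsStrongUnit u) (f : (E →ₗ[ℝ] ℝ) → ℝ)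
    (h : ∀ ε : ℝ, 0 < ε → ∃ w : E, ∀ φ, IsUnitalRieszHom u φ → |φ w - f φ| ≤ ε) :
    ∃ z : E, ∀ φ, IsUnitalRieszHom u φ → φ z = f φ := by
  -- `φ` need not preserve `sSup S`, but an approximant `w` traps it between `w - ε • u` and `w + ε
  -- • u`.
  set S : Set E := {w | ∀ φ, IsUnitalRieszHom u φ → φ w ≤ f φ}
  have hmem : ∀ ε w, (∀ φ, IsUnitalRieszHom u φ → |φ w - f φ| ≤ ε) → w - ε • u ∈ S := by
    intro ε w hw φ hφ
    have := abs_sub_le_iff.1 (hw φ hφ)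
    rw [map_sub, hφ.map_smul_unit]
    linarith [this.1]
  have hub : ∀ ε w, (∀ φ, IsUnitalRieszHom u φ → |φ w - f φ| ≤ ε) →
      w + ε • u ∈ upperBounds S := by
    intro ε w hw v hv
    refine le_of_forall_isUnitalRieszHom hu fun φ hφ => ?_
    have := abs_sub_le_iff.1 (hw φ hφ)
    rw [map_add, hφ.map_smul_unit]
    linarith [this.2, hv φ hφ]
  obtain ⟨w₁, hw₁⟩ := h 1 one_pos
  have hne : S.Nonempty := ⟨_, hmem 1 w₁ hw₁⟩
  have hbdd : BddAbove S := ⟨_, hub 1 w₁ hw₁⟩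
  refine ⟨sSup S, fun φ hφ => le_antisymm ?_ ?_⟩
  · refine le_of_forall_pos_le_add fun ε hε => ?_
    obtain ⟨w, hw⟩ := h (ε / 2) (half_pos hε)
    have h1 := hφ.mono (csSup_le hne (hub _ w hw))
    rw [map_add, hφ.map_smul_unit] at h1
    linarith [(abs_sub_le_iff.1 (hw φ hφ)).1]
  · refine le_of_forall_pos_le_add fun ε hε => ?_
    obtain ⟨w, hw⟩ := h (ε / 2) (half_pos hε)
    have h1 := hφ.mono (le_csSup hbdd (hmem _ w hw))
    rw [map_sub, hφ.map_smul_unit] at h1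
    linarith [(abs_sub_le_iff.1 (hw φ hφ)).2]

/-- The square is the upper envelope of its tangents `2 * t * s - t ^ 2`, and finite suprema of
these exist in `E`. -/
theorem exists_finset_sup_tangent (u x : E) (s : Finset ℝ) :
    ∃ w : E, ∀ φ : E →ₗ[ℝ] ℝ, IsUnitalRieszHom u φ →
      φ w ≤ φ x ^ 2 ∧ ∀ t ∈ s, 2 * t * φ x - t ^ 2 ≤ φ w := by
  induction s using Finset.induction_on with
  | empty => exact ⟨0, fun φ _ => by simp [sq_nonneg]⟩
  | insert a s _ ih =>
    obtain ⟨w, hw⟩ := ih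
    refine ⟨((2 * a) • x - a ^ 2 • u) ⊔ w, fun φ hφ => ?_⟩
    obtain ⟨h1, h2⟩ := hw φ hφ
    rw [hφ.map_sup, map_sub, hφ.map_smul_unit, map_smul, smul_eq_mul]
    refine ⟨sup_le (by nlinarith [sq_nonneg (φ x - a)]) h1, fun t ht => ?_⟩
    rcases Finset.mem_insert.1 ht with rfl | ht
    · exact le_sup_left
    · exact (h2 t ht).trans le_sup_right

theorem exists_square (hu : IsStrongUnit u) (x : E) :
    ∃ z : E, ∀ φ, IsUnitalRieszHom u φ → φ z = φ x ^ 2 := by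
  refine exists_of_forall_approx hu (fun φ => φ x ^ 2) fun ε hε => ?_
  obtain ⟨c, hc⟩ := hu.2 x
  -- The tangent at `s` misses the square by `(φ x - s) ^ 2`, hence a net of mesh `√ε`.
  obtain ⟨t, -, hfin, ht⟩ := Metric.finite_approx_of_totallyBounded
    (isCompact_Icc (a := -c) (b := c)).totallyBounded (√ε) (Real.sqrt_pos.2 hε)
  obtain ⟨w, hw⟩ := exists_finset_sup_tangent u x hfin.toFinset
  refine ⟨w, fun φ hφ => ?_⟩
  obtain ⟨h1, h2⟩ := hw φ hφ
  obtain ⟨s, hs, hd⟩ := Set.mem_iUnion₂.1 (ht (Set.mem_Icc.2 (abs_le.1 (hφ.abs_le hc))))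
  have h3 := h2 s (hfin.mem_toFinset.2 hs)
  rw [Metric.mem_ball, Real.dist_eq] at hd
  have h4 : (φ x - s) ^ 2 ≤ ε := by
    rw [← sq_abs, ← Real.sq_sqrt hε.le]
    exact pow_le_pow_left₀ (abs_nonneg _) hd.le 2
  rw [abs_le]
  constructor <;> nlinarith

theorem exists_product (hu : IsStrongUnit u) (x y : E) :
    ∃ z : E, ∀ φ, IsUnitalRieszHom u φ → φ z = φ x * φ y := by
  obtain ⟨a, ha⟩ := exists_square hu (x + y)
  obtain ⟨b, hb⟩ := exists_square hu (x - y)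
  refine ⟨(1 / 4 : ℝ) • (a - b), fun φ hφ => ?_⟩
  rw [map_smul, map_sub, ha φ hφ, hb φ hφ, map_add, map_sub, smul_eq_mul]
  ring

theorem exists_bilinear_product (hu : IsStrongUnit u) :
    ∃ m : E →ₗ[ℝ] E →ₗ[ℝ] E, ∀ φ, IsUnitalRieszHom u φ → ∀ x y, φ (m x y) = φ x * φ y := by
  choose f hf using exists_product hu
  refine ⟨LinearMap.mk₂ ℝ f ?_ ?_ ?_ ?_, fun φ hφ x y => hf x y φ hφ⟩ <;>
  · intros
    refine eq_of_forall_isUnitalRieszHom hu fun φ hφ => ?_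
    simp only [hf _ _ φ hφ, map_add, map_smul, smul_eq_mul]
    ring

theorem isFAlgebraMul_of_map_mul (hu : IsStrongUnit u) {m : E →ₗ[ℝ] E →ₗ[ℝ] E}
    (hm : ∀ φ, IsUnitalRieszHom u φ → ∀ x y, φ (m x y) = φ x * φ y) : IsFAlgebraMul u m := by
  have hcomm : ∀ x y, m x y = m y x := fun x y =>
    eq_of_forall_isUnitalRieszHom hu fun φ hφ => by rw [hm φ hφ, hm φ hφ, mul_comm]
  have hunit : ∀ x, m u x = x := fun x =>
    eq_of_forall_isUnitalRieszHom hu fun φ hφ => by rw [hm φ hφ, hφ.map_unit, one_mul]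
  have hdisj : ∀ x y z : E, x ⊓ y = 0 → 0 ≤ z → m z x ⊓ y = 0 := by
    intro x y z hxy hz
    refine eq_of_forall_isUnitalRieszHom hu fun φ hφ => ?_
    have h1 := hφ.map_inf x y
    rw [hxy, map_zero] at h1
    have hx : 0 ≤ φ x := h1.le.trans inf_le_left
    have hy : 0 ≤ φ y := h1.le.trans inf_le_right
    rw [hφ.map_inf, hm φ hφ, map_zero]
    -- Disjointness makes one of the two values zero.
    rcases min_choice (φ x) (φ y) with h | h
    · rw [← h1.trans h, mul_zero]
      exact inf_eq_left.2 hy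
    · rw [← h1.trans h]
      exact inf_eq_right.2 (mul_nonneg (hφ.nonneg hz) hx)
  refine ⟨fun x y z => ?_, fun x y hx hy => ?_, hdisj, fun x y z hxy hz => ?_, hunit, fun x => ?_⟩
  · refine eq_of_forall_isUnitalRieszHom hu fun φ hφ => ?_
    simp only [hm φ hφ, mul_assoc]
  · refine le_of_forall_isUnitalRieszHom hu fun φ hφ => ?_
    rw [map_zero, hm φ hφ]
    exact mul_nonneg (hφ.nonneg hx) (hφ.nonneg hy)
  · rw [hcomm]
    exact hdisj x y z hxy hz
  · rw [hcomm]
    exact hunit x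

/-- The kernel of `φ` absorbs products, since `0 ≤ a ≤ c • u` squeezes `m a b` between `0` and `c •
b`; apply this to `y - φ y • u`. -/
theorem IsFAlgebraMul.map_mul {m : E →ₗ[ℝ] E →ₗ[ℝ] E} (hm : IsFAlgebraMul u m)
    (hu : IsStrongUnit u) {φ : E →ₗ[ℝ] ℝ} (hφ : IsUnitalRieszHom u φ) (x y : E) :
    φ (m x y) = φ x * φ y := by
  have hpos : ∀ a b : E, 0 ≤ a → 0 ≤ b → φ b = 0 → φ (m a b) = 0 := by
    intro a b ha hb hb0
    obtain ⟨c, hc⟩ := hu.2 a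
    have h1 := hm.nonneg _ _ (sub_nonneg.2 ((le_abs_self a).trans hc)) hb
    rw [map_sub, map_smul, LinearMap.sub_apply, LinearMap.smul_apply, hm.unit_mul] at h1
    have h2 := hφ.nonneg h1
    rw [map_sub, map_smul, hb0, smul_zero, zero_sub] at h2
    exact le_antisymm (by linarith) (hφ.nonneg (hm.nonneg a b ha hb))
  have hker : ∀ b : E, φ b = 0 → φ (m x b) = 0 := by
    intro b hb
    have hsup : ∀ d : E, φ d = 0 → φ d⁺ = 0 := fun d hd => by
      rw [posPart_def, hφ.map_sup, hd, map_zero, sup_idem]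
    have hb1 := hsup b hb
    have hb2 : φ b⁻ = 0 := by
      rw [← posPart_neg]
      exact hsup (-b) (by rw [map_neg, hb, neg_zero])
    have hx1 := posPart_nonneg x
    have hx2 := negPart_nonneg x
    rw [← posPart_sub_negPart b, ← posPart_sub_negPart x]
    simp only [map_sub, LinearMap.sub_apply, hpos _ _ hx1 (posPart_nonneg b) hb1,
      hpos _ _ hx2 (posPart_nonneg b) hb1, hpos _ _ hx1 (negPart_nonneg b) hb2,
      hpos _ _ hx2 (negPart_nonneg b) hb2, sub_self]
  have h := hker (y - φ y • u) (by rw [map_sub, hφ.map_smul_unit, sub_self])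
  rw [map_sub, map_smul, hm.mul_unit, map_sub, map_smul, smul_eq_mul] at h
  linarith

theorem existsUnique_isFAlgebraMul (hu : IsStrongUnit u) :
    ∃! m : E →ₗ[ℝ] E →ₗ[ℝ] E, IsFAlgebraMul u m := by
  obtain ⟨m, hm⟩ := exists_bilinear_product hu
  refine ⟨m, isFAlgebraMul_of_map_mul hu hm, fun m' hm' => ?_⟩
  ext x y
  refine eq_of_forall_isUnitalRieszHom hu fun φ hφ => ?_
  rw [hm φ hφ, hm'.map_mul hu hφ]

theorem IsFAlgebraMul.map_expPartialSum {m : E →ₗ[ℝ] E →ₗ[ℝ] E} (hm : IsFAlgebraMul u m)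
    (hu : IsStrongUnit u) {φ : E →ₗ[ℝ] ℝ} (hφ : IsUnitalRieszHom u φ) (x : E) (n : ℕ) :
    φ (expPartialSum u m x n) = ∑ k ∈ Finset.range (n + 1), φ x ^ k / (k.factorial : ℝ) := by
  have hpow : ∀ k, φ (fPow u m x k) = φ x ^ k := by
    intro k
    induction k with
    | zero => rw [fPow, hφ.map_unit, pow_zero]
    | succ k ih => rw [fPow, hm.map_mul hu hφ, ih, pow_succ]
  rw [expPartialSum, map_sum]
  refine Finset.sum_congr rfl fun k _ => ?_
  rw [map_smul, hpow, smul_eq_mul]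
  ring

end DedekindComplete

/-! ### Convergence of the exponential series. -/

theorem IsStrongUnit.exists_nonneg {E : Type*} [AddCommGroup E] [Lattice E] [Module ℝ E]
    [IsOrderedAddMonoid E] [IsOrderedModule ℝ E] {u : E} (hu : IsStrongUnit u) (x : E) :
    ∃ c : ℝ, 0 ≤ c ∧ |x| ≤ c • u := by
  obtain ⟨c, hc⟩ := hu.2 x
  exact ⟨|c|, abs_nonneg c, hc.trans (smul_le_smul_of_nonneg_right (le_abs_self c) hu.1)⟩

theorem hasSum_real_exp (t : ℝ) :
    HasSum (fun k : ℕ => t ^ k / (k.factorial : ℝ)) (Real.exp t) := by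
  rw [Real.exp_eq_exp_ℝ]
  exact NormedSpace.expSeries_div_hasSum_exp t

theorem abs_exp_partialSum_sub_le {t c : ℝ} (h : |t| ≤ c) (n : ℕ) :
    |∑ k ∈ Finset.range n, t ^ k / (k.factorial : ℝ) - Real.exp t| ≤
      Real.exp c - ∑ k ∈ Finset.range n, c ^ k / (k.factorial : ℝ) := by
  have ht := (hasSum_nat_add_iff' n).2 (hasSum_real_exp t)
  have hc := (hasSum_nat_add_iff' n).2 (hasSum_real_exp c)
  rw [abs_sub_comm, ← Real.norm_eq_abs]
  refine ht.norm_le_of_bounded hc fun k => ?_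
  rw [Real.norm_eq_abs, abs_div, abs_pow, Nat.abs_cast]
  gcongr

theorem OrderTendsto.unique {E : Type*} [AddCommGroup E] [Lattice E] [IsOrderedAddMonoid E]
    {s : ℕ → E} {y z : E} (hy : OrderTendsto s y) (hz : OrderTendsto s z) : z = y := by
  obtain ⟨p, hp, hp0, hsp⟩ := hy
  obtain ⟨q, hq, hq0, hsq⟩ := hz
  have h1 : ∀ n, |z - y| ≤ q n + p n := by
    intro n
    rw [← sub_add_sub_cancel z (s n) y]
    refine (abs_add_le _ _).trans (add_le_add ?_ (hsp n))
    rw [abs_sub_comm]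
    exact hsq n
  -- Decoupling the indices lets the two infima be taken one after the other.
  have h2 : ∀ k n, |z - y| ≤ q n + p k := by
    intro k n
    rcases le_total k n with h | h
    · exact (h1 n).trans (add_le_add le_rfl (hp h))
    · exact (h1 k).trans (add_le_add (hq h) le_rfl)
  have h3 : |z - y| ∈ lowerBounds (Set.range p) := by
    rintro _ ⟨k, rfl⟩
    rw [← sub_nonpos]
    refine hq0.2 ?_
    rintro _ ⟨n, rfl⟩
    exact sub_le_iff_le_add.2 (h2 k n)
  have h4 := abs_le'.1 (hp0.2 h3)
  exact sub_eq_zero.1 (le_antisymm h4.1 (neg_nonpos.1 h4.2))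

theorem mainTheorem9 {E : Type*} [AddCommGroup E] [ConditionallyCompleteLattice E]
    [IsOrderedAddMonoid E] [Module ℝ E] [IsOrderedModule ℝ E]
    (u : E) (hu : IsStrongUnit u) :
    (∃! m : E →ₗ[ℝ] E →ₗ[ℝ] E, IsFAlgebraMul u m) ∧
    ∀ m : E →ₗ[ℝ] E →ₗ[ℝ] E, IsFAlgebraMul u m → ∀ x : E,
      ∃ y : E, OrderTendsto (expPartialSum u m x) y ∧
        RelUniformTendsto u (expPartialSum u m x) y ∧
        ∀ z : E, OrderTendsto (expPartialSum u m x) z → z = y := by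
  refine ⟨existsUnique_isFAlgebraMul hu, fun m hm x => ?_⟩
  obtain ⟨c, hc0, hc⟩ := hu.exists_nonneg x
  -- The Taylor remainder at `c` dominates those at all `φ x` at once.
  set r : ℕ → ℝ := fun n =>
    Real.exp c - ∑ k ∈ Finset.range (n + 1), c ^ k / (k.factorial : ℝ) with hr
  have hbound : ∀ n φ, IsUnitalRieszHom u φ →
      |φ (expPartialSum u m x n) - Real.exp (φ x)| ≤ r n := fun n φ hφ => by
    rw [hm.map_expPartialSum hu hφ]
    exact abs_exp_partialSum_sub_le (hφ.abs_le hc) (n + 1)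
  have hlim : Filter.Tendsto r Filter.atTop (nhds 0) := by
    have h := ((hasSum_real_exp c).tendsto_sum_nat.comp
      (Filter.tendsto_add_atTop_nat 1)).const_sub (Real.exp c)
    rwa [sub_self] at h
  have hsmall : ∀ ε : ℝ, 0 < ε → ∃ N, ∀ n ≥ N, r n ≤ ε := fun ε hε =>
    Filter.eventually_atTop.1 (hlim.eventually_le_const hε)
  obtain ⟨y, hy⟩ := exists_of_forall_approx hu (fun φ => Real.exp (φ x)) fun ε hε => by
    obtain ⟨N, hN⟩ := hsmall ε hε
    exact ⟨expPartialSum u m x N, fun φ hφ => (hbound N φ hφ).trans (hN N le_rfl)⟩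
  have hSy : ∀ n, |expPartialSum u m x n - y| ≤ r n • u := fun n =>
    le_of_forall_isUnitalRieszHom hu fun φ hφ => by
      rw [hφ.map_abs, map_sub, hy φ hφ, hφ.map_smul_unit]
      exact hbound n φ hφ
  have horder : OrderTendsto (expPartialSum u m x) y := by
    refine ⟨fun n => r n • u, ?_, ⟨?_, fun w hw => ?_⟩, hSy⟩
    · refine antitone_nat_of_succ_le fun n => smul_le_smul_of_nonneg_right ?_ hu.1
      simp only [hr, Finset.sum_range_succ _ (n + 1)]
      have : 0 ≤ c ^ (n + 1) / ((n + 1).factorial : ℝ) := by positivity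
      linarith
    · rintro _ ⟨n, rfl⟩
      exact (abs_nonneg _).trans (hSy n)
    · refine nonpos_of_forall_le_smul (u := u) fun ε hε => ?_
      obtain ⟨N, hN⟩ := hsmall ε hε
      exact (hw ⟨N, rfl⟩).trans (smul_le_smul_of_nonneg_right (hN N le_rfl) hu.1)
  refine ⟨y, horder, fun ε hε => ?_, fun z hz => horder.unique hz⟩
  obtain ⟨N, hN⟩ := hsmall ε hε
  exact ⟨N, fun n hn => (hSy n).trans (smul_le_smul_of_nonneg_right (hN n hn) hu.1)⟩
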